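/- Let $N\ge 2$ and let $Y=(Y_1,\dots,Y_N)$ be a Gaussian vector with independent, zero-mean components of variances $\sigma_i=E(Y_i^2)$, where $\sigma_1\ge\sigma_2\ge\dots\ge\sigma_N\ge 0$. For an orthogonal matrix $T\in O(N)$ put $X=TY$ and let $$\mathcal E(T)=E\Big(\min_{i_1,\dots,i_{N-1}\ \text{distinct}}\ \sum_{j=1}^{N-1}X_{i_j}^2\Big)$$ be the mean square error of reconstructing $X$ from its single largest (in absolute value) coordinate. Let $\mathcal P\subset O(N)$ be the set of permutation and reflection matrices, i.e. the orthogonal matrices with all entries in $\{0,1,-1\}$. Then $\mathcal E(T)$ is finite for every $T\in O(N)$, and $$\min_{T\in O(N)}\mathcal E(T)=\min_{T\in\mathcal P}\mathcal E(T)=\mathcal E(I),$$ where both minima are attained at the identity $I$; moreover $\mathcal E(T)=\mathcal E(I)$ for every $T\in\mathcal P$. -/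

import Mathlib

open MeasureTheory ProbabilityTheory
open scoped NNReal

noncomputable section

/-- The squared error of reconstructing `x ∈ ℝ^N` from its `M` largest (in absolute value)
coordinates: the least sum of squares `∑ j, x_{i_j} ^ 2` over `N - M` distinct indices
`i_1, …, i_{N-M}`, i.e. over the `(N - M)`-element sets of discarded coordinates. -/
def sqErr {N : ℕ} (M : ℕ) (x : Fin N → ℝ) : ℝ :=
  ((Finset.univ : Finset (Fin N)).powersetCard (N - M)).inf'
    (Finset.powersetCard_nonempty.2 (by simp))
    (fun S => ∑ i ∈ S, x i ^ 2)

/-- The squared reconstruction error, at the sample point `ω`, of the vector `X = T Y` from its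
`M` largest coordinates. -/
def sqErrAt {Ω : Type*} {N : ℕ} (Y : Ω → Fin N → ℝ) (M : ℕ)
    (T : Matrix.orthogonalGroup (Fin N) ℝ) (ω : Ω) : ℝ :=
  sqErr M (Matrix.mulVec (T : Matrix (Fin N) (Fin N) ℝ) (Y ω))

/-- The mean square error of reconstructing `X = T Y` from its `M` largest coordinates. -/
def meanSqErr {Ω : Type*} [MeasurableSpace Ω] (P : Measure Ω) {N : ℕ} (Y : Ω → Fin N → ℝ)
    (M : ℕ) (T : Matrix.orthogonalGroup (Fin N) ℝ) : ℝ :=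
  ∫ ω, sqErrAt Y M T ω ∂P

/-- The permutation-and-reflection (signed permutation) matrices: the orthogonal matrices all of
whose entries are `0`, `1` or `-1`. -/
def signedPerms (N : ℕ) : Set (Matrix.orthogonalGroup (Fin N) ℝ) :=
  {T | ∀ i j, (T : Matrix (Fin N) (Fin N) ℝ) i j = 0 ∨
    (T : Matrix (Fin N) (Fin N) ℝ) i j = 1 ∨ (T : Matrix (Fin N) (Fin N) ℝ) i j = -1}

end

/-!
By orthogonality of `T`, the squared error of `X = T Y` is `∑ i, Y i ^ 2 - ‖T Y‖ ^ 2` for the sup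
norm (`sqErrAt_one_eq`), so the claim is that `E ‖T Y‖ ^ 2 ≤ E ‖Y‖ ^ 2`
(`lintegral_sq_norm_orthogonal_le`). Signed permutations preserve the sup norm, which gives the
remaining assertions pointwise.

The coordinate `X i` is a centred Gaussian of variance `d i = ∑ j, T i j ^ 2 * σ j`. The inequality
is proved in two steps.

* *Decoupling.* Šidák's inequality (`prod_measure_slab_le`) says that
  `P (∀ i, |X i| ≤ s) ≥ ∏ i, P (|X i| ≤ s)`: replacing the coordinates of `X` by independent ones
  with the same variances makes the maximum stochastically larger, hence
  `E ‖X‖ ^ 2 ≤ E max (d i * Z i ^ 2)` with `Z` standard Gaussian (`lintegral_sq_norm_mulVec_le`).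
* *Majorization.* The matrix `T i j ^ 2` is doubly stochastic, so by Birkhoff's theorem `d` is a
  convex combination of permutations of `σ`. Since `E max (d i * Z i ^ 2)` is a convex and symmetric
  function of `d`, it is at most its value at `σ` (`lintegral_sq_norm_doublyStochastic_le`).

Šidák's inequality is obtained by conditioning on one coordinate `X k`. The conditional probability
of the other slabs given `X k = x` is an even function of `x`, and it decreases with `|x|` because
Gaussian measures are log-concave (`measure_shifted_slabs_le`); an even function decreasing with
`|x|` is positively correlated with the indicator of a symmetric interval. Log-concavity of the
standard Gaussian measure is the Prékopa–Leindler inequality, proved on the line from the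
Brunn–Minkowski inequality and carried to `ℝⁿ` by its stability under products.
-/

open scoped ENNReal Pointwise

/-! ### The Brunn–Minkowski and Prékopa–Leindler inequalities on the line -/

theorem volume_add_volume_le_of_isCompact {K L C : Set ℝ} (hK : IsCompact K) (hL : IsCompact L)
    (hK0 : K.Nonempty) (hL0 : L.Nonempty) (hC : ∀ a ∈ K, ∀ b ∈ L, a + b ∈ C) :
    volume K + volume L ≤ volume C := by
  set k := sSup K
  set m := sInf L
  have hk : k ∈ K := hK.sSup_mem hK0
  have hm : m ∈ L := hL.sInf_mem hL0
  have h1 : volume ((fun x => x + (-m)) ⁻¹' K) = volume K := measure_preimage_add_right _ _ _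
  have h2 : volume ((fun x => (-k) + x) ⁻¹' L) = volume L := measure_preimage_add _ _ _
  rw [← h1, ← h2, ← measure_union₀]
  · refine measure_mono ?_
    rintro x (hx | hx)
    · simpa using hC _ hx _ hm
    · simpa using hC _ hk _ hx
  · exact (hL.measurableSet.preimage (by fun_prop)).nullMeasurableSet
  · refine measure_mono_null (t := {k + m}) ?_ (by simp)
    rintro x ⟨hx1, hx2⟩
    have := le_csSup hK.bddAbove hx1
    have := csInf_le hL.bddBelow hx2
    simp only [Set.mem_singleton_iff]
    linarith

/-- The one-dimensional Brunn–Minkowski inequality. The set `C` plays the role of `A + B`, which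
need not be measurable. -/
theorem volume_add_volume_le {A B C : Set ℝ} (hA : MeasurableSet A) (hB : MeasurableSet B)
    (hA0 : A.Nonempty) (hB0 : B.Nonempty) (hC : ∀ a ∈ A, ∀ b ∈ B, a + b ∈ C) :
    volume A + volume B ≤ volume C := by
  obtain ⟨a, ha⟩ := hA0
  obtain ⟨b, hb⟩ := hB0
  simp_rw [hA.measure_eq_iSup_isCompact, hB.measure_eq_iSup_isCompact, iSup_and']
  refine ENNReal.biSup_add_biSup_le' ⟨∅, by simp⟩ ⟨∅, by simp⟩ fun K hK L hL => ?_
  -- Adjoining a point of `A` to `K` and a point of `B` to `L` makes both compact sets nonempty.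
  calc volume K + volume L ≤ volume (insert a K) + volume (insert b L) := by
        gcongr <;> exact Set.subset_insert _ _
    _ ≤ volume C := by
        refine volume_add_volume_le_of_isCompact (hK.2.insert a) (hL.2.insert b)
          (Set.insert_nonempty _ _) (Set.insert_nonempty _ _) fun x hx y hy => hC x ?_ y ?_
        · exact Set.insert_subset ha hK.1 hx
        · exact Set.insert_subset hb hL.1 hy

theorem ENNReal.rpow_mul_rpow_le_add {l : ℝ} (h0 : 0 < l) (h1 : l < 1) (a b : ℝ≥0∞) :
    a ^ (1 - l) * b ^ l ≤ ENNReal.ofReal (1 - l) * a + ENNReal.ofReal l * b := by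
  have h1' : 0 < 1 - l := sub_pos.2 h1
  by_cases ha : a = ∞
  · simp [ha, ENNReal.mul_top, h1]
  by_cases hb : b = ∞
  · simp [hb, ENNReal.mul_top, h0]
  lift a to ℝ≥0 using ha
  lift b to ℝ≥0 using hb
  lift l to ℝ≥0 using h0.le
  have := NNReal.geom_mean_le_arith_mean2_weighted (Real.toNNReal (1 - l)) l a b (by
    ext; simp [h1'.le])
  rw [← ENNReal.coe_rpow_of_nonneg _ h1'.le, ← ENNReal.coe_rpow_of_nonneg _ h0.le,
    ENNReal.ofReal_coe_nnreal, ENNReal.ofReal]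
  rw [Real.coe_toNNReal _ h1'.le] at this
  exact_mod_cast this

theorem ENNReal.rpow_one_sub_mul_rpow {l : ℝ} (h0 : 0 < l) (h1 : l < 1) (a : ℝ≥0∞) :
    a ^ (1 - l) * a ^ l = a := by
  rw [← ENNReal.rpow_add_of_nonneg _ _ (sub_pos.2 h1).le h0.le]; simp

/-- The Prékopa–Leindler inequality for functions with supremum `1`, where it follows from the
Brunn–Minkowski inequality for superlevel sets and takes the stronger, arithmetic-mean form. -/
theorem lintegral_add_lintegral_le_of_sup_eq_one {l : ℝ} (h0 : 0 < l) (h1 : l < 1)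
    {f g h : ℝ → ℝ≥0∞} (hf : Measurable f) (hg : Measurable g) (hh : Measurable h)
    (hf1 : ⨆ x, f x = 1) (hg1 : ⨆ x, g x = 1)
    (H : ∀ x y, f x ^ (1 - l) * g y ^ l ≤ h ((1 - l) * x + l * y)) :
    ENNReal.ofReal (1 - l) * (∫⁻ x, f x) + ENNReal.ofReal l * (∫⁻ x, g x) ≤ ∫⁻ x, h x := by
  have h1' : 0 < 1 - l := sub_pos.2 h1
  -- The layer cake formula, to be applied to `f`, `g` and the truncation of `h` at `1`.
  have layer (k : ℝ → ℝ≥0∞) (hk : Measurable k) (hk1 : ∀ x, k x ≤ 1) :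
      ∫⁻ x, k x = ∫⁻ t in Set.Ioi (0 : ℝ), volume {x | ENNReal.ofReal t < k x} := by
    have hfin (x) : k x ≠ ∞ := ((hk1 x).trans_lt ENNReal.one_lt_top).ne
    calc ∫⁻ x, k x = ∫⁻ x, ENNReal.ofReal (k x).toReal := by
          simp_rw [ENNReal.ofReal_toReal (hfin _)]
      _ = _ := by
          rw [lintegral_eq_lintegral_meas_lt _ (.of_forall fun x => ENNReal.toReal_nonneg)
            hk.ennreal_toReal.aemeasurable]
          refine setLIntegral_congr_fun measurableSet_Ioi fun t ht => ?_
          simp only [ENNReal.ofReal_lt_iff_lt_toReal (le_of_lt ht) (hfin _)]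
  have hmeas (k : ℝ → ℝ≥0∞) : Measurable fun t : ℝ => volume {x | ENNReal.ofReal t < k x} := by
    refine Antitone.measurable fun s t hst => measure_mono fun x hx => ?_
    exact (ENNReal.ofReal_le_ofReal hst).trans_lt hx
  have hf1' (x) : f x ≤ 1 := hf1 ▸ le_iSup f x
  have hg1' (x) : g x ≤ 1 := hg1 ▸ le_iSup g x
  calc _ ≤ ∫⁻ x, min (h x) 1 := by
        rw [layer f hf hf1', layer g hg hg1', layer _ (hh.min measurable_const)
          fun x => min_le_right _ _, ← lintegral_const_mul _ (hmeas f),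
          ← lintegral_const_mul _ (hmeas g), ← lintegral_add_left ((hmeas f).const_mul _)]
        refine setLIntegral_mono (hmeas _) fun t ht => ?_
        rcases le_or_gt 1 t with ht1 | ht1
        · have h1t : 1 ≤ ENNReal.ofReal t := by simpa using ht1
          simp [fun x => ((hf1' x).trans h1t).not_gt, fun x => ((hg1' x).trans h1t).not_gt]
        have h1t : ENNReal.ofReal t < 1 := by simpa using ht1
        have scale {c : ℝ} (hc : 0 < c) (A : Set ℝ) :
            ENNReal.ofReal c * volume A = volume (c • A) := by
          rw [Measure.addHaar_smul]; simp [abs_of_pos hc]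
        rw [scale h1', scale h0]
        refine volume_add_volume_le
          ((measurableSet_lt measurable_const hf).const_smul₀ _)
          ((measurableSet_lt measurable_const hg).const_smul₀ _) ?_ ?_ ?_
        · exact Set.Nonempty.smul_set (lt_iSup_iff.1 (h1t.trans_eq hf1.symm))
        · exact Set.Nonempty.smul_set (lt_iSup_iff.1 (h1t.trans_eq hg1.symm))
        · rintro _ ⟨x, hx, rfl⟩ _ ⟨y, hy, rfl⟩
          refine lt_min ?_ h1t
          refine lt_of_lt_of_le ?_ (H x y)
          rw [← ENNReal.rpow_one_sub_mul_rpow h0 h1 (ENNReal.ofReal t)]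
          exact ENNReal.mul_lt_mul (ENNReal.rpow_lt_rpow hx h1') (ENNReal.rpow_lt_rpow hy h0)
    _ ≤ ∫⁻ x, h x := lintegral_mono fun x => min_le_left _ _

theorem prekopa_leindler_of_sup_ne_top {l : ℝ} (h0 : 0 < l) (h1 : l < 1)
    {f g h : ℝ → ℝ≥0∞} (hf : Measurable f) (hg : Measurable g) (hh : Measurable h)
    (hf1 : ⨆ x, f x ≠ ∞) (hg1 : ⨆ x, g x ≠ ∞)
    (H : ∀ x y, f x ^ (1 - l) * g y ^ l ≤ h ((1 - l) * x + l * y)) :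
    (∫⁻ x, f x) ^ (1 - l) * (∫⁻ x, g x) ^ l ≤ ∫⁻ x, h x := by
  have h1' : 0 < 1 - l := sub_pos.2 h1
  set a := ⨆ x, f x with ha
  set b := ⨆ x, g x with hb
  by_cases ha0 : a = 0
  · have : ∀ x, f x = 0 := by simpa using ha.symm.trans ha0
    simp [this, h1']
  by_cases hb0 : b = 0
  · have : ∀ x, g x = 0 := by simpa using hb.symm.trans hb0
    simp [this, h0]
  set c := a ^ (1 - l) * b ^ l with hc
  have hc0 : c ≠ 0 := by simp [hc, ha0, hb0, hf1, hg1]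
  have hct : c ≠ ∞ := ENNReal.mul_ne_top (by simp [ha0, hf1]) (by simp [hb0, hg1])
  have hcinv : (a⁻¹) ^ (1 - l) * (b⁻¹) ^ l = c⁻¹ := by
    rw [hc, ENNReal.mul_inv (by simp [ha0, hf1]) (by simp [hb0, hg1]), ENNReal.inv_rpow,
      ENNReal.inv_rpow]
  have split (u v : ℝ≥0∞) : (a⁻¹ * u) ^ (1 - l) * (b⁻¹ * v) ^ l
      = c⁻¹ * (u ^ (1 - l) * v ^ l) := by
    rw [ENNReal.mul_rpow_of_nonneg _ _ h1'.le, ENNReal.mul_rpow_of_nonneg _ _ h0.le, ← hcinv]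
    ring
  have key := lintegral_add_lintegral_le_of_sup_eq_one h0 h1 (hf.const_mul a⁻¹)
    (hg.const_mul b⁻¹) (hh.const_mul c⁻¹)
    (by rw [← ENNReal.mul_iSup, ← ha, ENNReal.inv_mul_cancel ha0 hf1])
    (by rw [← ENNReal.mul_iSup, ← hb, ENNReal.inv_mul_cancel hb0 hg1])
    (fun x y => by rw [split]; gcongr; exact H x y)
  have key2 := (ENNReal.rpow_mul_rpow_le_add h0 h1 _ _).trans key
  rw [lintegral_const_mul _ hf, lintegral_const_mul _ hg, lintegral_const_mul _ hh, split] at key2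
  exact (ENNReal.mul_le_mul_iff_right (by simpa using hct) (by simpa using hc0)).1 key2

/-! ### Log-concave measures -/

/-- A measure is log-concave if it satisfies the Prékopa–Leindler inequality. This functional form
of `μ A ^ (1 - l) * μ B ^ l ≤ μ ((1 - l) • A + l • B)` is the one that passes to products. -/
def IsLogConcave {E : Type*} [AddCommGroup E] [Module ℝ E] [MeasurableSpace E]
    (μ : Measure E) : Prop :=
  ∀ ⦃l : ℝ⦄, 0 < l → l < 1 → ∀ ⦃f g h : E → ℝ≥0∞⦄, Measurable f → Measurable g → Measurable h →
    (∀ x y, f x ^ (1 - l) * g y ^ l ≤ h ((1 - l) • x + l • y)) →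
    (∫⁻ x, f x ∂μ) ^ (1 - l) * (∫⁻ x, g x ∂μ) ^ l ≤ ∫⁻ x, h x ∂μ

/-- The one-dimensional Prékopa–Leindler inequality. -/
theorem isLogConcave_volume_real : IsLogConcave (volume : Measure ℝ) := by
  intro l h0 h1 f g h hf hg hh H
  have h1' : 0 < 1 - l := sub_pos.2 h1
  have trunc (k : ℝ → ℝ≥0∞) (hk : Measurable k) :
      ∫⁻ x, k x = ⨆ n : ℕ, ∫⁻ x, min (k x) n := by
    rw [← lintegral_iSup (fun n => hk.min measurable_const)
      (fun m n hmn x => by dsimp only; gcongr)]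
    simp_rw [← inf_iSup_eq, ENNReal.iSup_natCast, inf_top_eq]
  have bdd (k : ℝ → ℝ≥0∞) (n : ℕ) : ⨆ x, min (k x) n ≠ ∞ :=
    ((iSup_le fun x => min_le_right _ _).trans_lt (ENNReal.natCast_lt_top n)).ne
  have step (m n : ℕ) :
      (∫⁻ x, min (f x) m) ^ (1 - l) * (∫⁻ x, min (g x) n) ^ l ≤ ∫⁻ x, h x := by
    refine prekopa_leindler_of_sup_ne_top h0 h1 (hf.min measurable_const)
      (hg.min measurable_const) hh (bdd f m) (bdd g n) fun x y => le_trans ?_ (H x y)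
    gcongr <;> exact min_le_left _ _
  have rpow_iSup {p : ℝ} (hp : 0 < p) (u : ℕ → ℝ≥0∞) : (⨆ n, u n) ^ p = ⨆ n, u n ^ p :=
    (ENNReal.orderIsoRpow p hp).map_iSup u
  rw [trunc f hf, trunc g hg, rpow_iSup h1', rpow_iSup h0]
  simp_rw [ENNReal.iSup_mul, ENNReal.mul_iSup]
  exact iSup₂_le step

namespace IsLogConcave

variable {E F : Type*} [AddCommGroup E] [Module ℝ E] [MeasurableSpace E]
  [AddCommGroup F] [Module ℝ F] [MeasurableSpace F]

theorem dirac (x : E) : IsLogConcave (Measure.dirac x) := by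
  intro l h0 h1 f g h hf hg hh H
  rw [lintegral_dirac' _ hf, lintegral_dirac' _ hg, lintegral_dirac' _ hh]
  simpa [← add_smul] using H x x

theorem map {μ : Measure E} (hμ : IsLogConcave μ) (L : E →ₗ[ℝ] F) (hL : Measurable L) :
    IsLogConcave (μ.map L) := by
  intro l h0 h1 f g h hf hg hh H
  rw [lintegral_map hf hL, lintegral_map hg hL, lintegral_map hh hL]
  exact hμ h0 h1 (hf.comp hL) (hg.comp hL) (hh.comp hL) fun x y => by simpa using H (L x) (L y)

theorem prod {μ : Measure E} {ν : Measure F} [SFinite ν] (hμ : IsLogConcave μ)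
    (hν : IsLogConcave ν) : IsLogConcave (μ.prod ν) := by
  intro l h0 h1 f g h hf hg hh H
  rw [lintegral_prod _ hf.aemeasurable, lintegral_prod _ hg.aemeasurable,
    lintegral_prod _ hh.aemeasurable]
  refine hμ h0 h1 hf.lintegral_prod_right' hg.lintegral_prod_right' hh.lintegral_prod_right'
    fun x y => ?_
  exact hν h0 h1 (hf.comp measurable_prodMk_left) (hg.comp measurable_prodMk_left)
    (hh.comp measurable_prodMk_left) fun u v => H (x, u) (y, v)

theorem withDensity {μ : Measure E} (hμ : IsLogConcave μ) {ρ : E → ℝ≥0∞} (hρ : Measurable ρ)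
    (hρc : ∀ ⦃l : ℝ⦄, 0 < l → l < 1 → ∀ x y,
      ρ x ^ (1 - l) * ρ y ^ l ≤ ρ ((1 - l) • x + l • y)) :
    IsLogConcave (μ.withDensity ρ) := by
  intro l h0 h1 f g h hf hg hh H
  rw [lintegral_withDensity_eq_lintegral_mul _ hρ hf,
    lintegral_withDensity_eq_lintegral_mul _ hρ hg, lintegral_withDensity_eq_lintegral_mul _ hρ hh]
  refine hμ h0 h1 (hρ.mul hf) (hρ.mul hg) (hρ.mul hh) fun x y => ?_
  simp only [Pi.mul_apply]
  rw [ENNReal.mul_rpow_of_nonneg _ _ (sub_pos.2 h1).le, ENNReal.mul_rpow_of_nonneg _ _ h0.le,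
    mul_mul_mul_comm]
  exact mul_le_mul' (hρc h0 h1 x y) (H x y)

theorem pi {n : ℕ} {μ : Fin n → Measure ℝ} [∀ i, SigmaFinite (μ i)]
    (hμ : ∀ i, IsLogConcave (μ i)) : IsLogConcave (Measure.pi μ) := by
  induction n with
  | zero => rw [Measure.pi_of_empty μ 0]; exact dirac _
  | succ n ih =>
    let L : (ℝ × (Fin n → ℝ)) →ₗ[ℝ] (Fin (n + 1) → ℝ) :=
      { toFun := fun p => Fin.cons p.1 p.2
        map_add' := fun p q => by ext i; refine Fin.cases ?_ (fun j => ?_) i <;> simp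
        map_smul' := fun c p => by ext i; refine Fin.cases ?_ (fun j => ?_) i <;> simp }
    have hL := (measurePreserving_piFinSuccAbove μ 0).symm
    have hLeq : ⇑L = ⇑(MeasurableEquiv.piFinSuccAbove (fun _ => ℝ) (0 : Fin (n + 1))).symm := by
      ext p i
      simp [L, MeasurableEquiv.piFinSuccAbove_symm_apply, Fin.insertNthEquiv]
    rw [← hL.map_eq, ← hLeq]
    refine ((hμ 0).prod (ih fun i => hμ _)).map L ?_
    rw [hLeq]
    exact MeasurableEquiv.measurable _

/-- The set form of log-concavity. -/
theorem measure_rpow_mul_le {μ : Measure E} (hμ : IsLogConcave μ) {l : ℝ} (h0 : 0 < l) (h1 : l < 1)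
    {A B C : Set E} (hA : MeasurableSet A) (hB : MeasurableSet B) (hC : MeasurableSet C)
    (H : ∀ x ∈ A, ∀ y ∈ B, (1 - l) • x + l • y ∈ C) :
    μ A ^ (1 - l) * μ B ^ l ≤ μ C := by
  have := hμ h0 h1 (measurable_const.indicator hA) (measurable_const.indicator hB)
    (measurable_const.indicator hC) (f := A.indicator 1) (g := B.indicator 1)
    (h := C.indicator 1) fun x y => ?_
  · rwa [lintegral_indicator_one hA, lintegral_indicator_one hB, lintegral_indicator_one hC]
      at this
  · by_cases hx : x ∈ A
    · by_cases hy : y ∈ B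
      · simp [hx, hy, H x hx y hy]
      · simp [hy, h0]
    · simp [hx, h1]

end IsLogConcave

theorem isLogConcave_gaussianReal_zero_one : IsLogConcave (gaussianReal 0 1) := by
  rw [gaussianReal_of_var_ne_zero 0 one_ne_zero]
  refine isLogConcave_volume_real.withDensity (measurable_gaussianPDF 0 1) fun l h0 h1 x y => ?_
  have h1' : 0 < 1 - l := sub_pos.2 h1
  have hpos (z : ℝ) := gaussianPDFReal_pos 0 1 z one_ne_zero
  simp only [gaussianPDF]
  rw [ENNReal.ofReal_rpow_of_pos (hpos x), ENNReal.ofReal_rpow_of_pos (hpos y),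
    ← ENNReal.ofReal_mul (Real.rpow_nonneg (hpos x).le _)]
  refine ENNReal.ofReal_le_ofReal ?_
  have hc : 0 < (√(2 * Real.pi * (1 : ℝ≥0)))⁻¹ := by positivity
  simp only [gaussianPDFReal]
  rw [Real.mul_rpow hc.le (Real.exp_pos _).le, Real.mul_rpow hc.le (Real.exp_pos _).le,
    mul_mul_mul_comm, ← Real.rpow_add hc, ← Real.exp_mul, ← Real.exp_mul, ← Real.exp_add]
  simp only [sub_add_cancel, Real.rpow_one, sub_zero, NNReal.coe_one, mul_one, smul_eq_mul]
  gcongr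
  nlinarith [mul_nonneg (mul_nonneg h0.le h1'.le) (sq_nonneg (x - y))]

/-- The standard Gaussian measure on `ℝⁿ` is log-concave. -/
theorem isLogConcave_pi_gaussianReal (n : ℕ) :
    IsLogConcave (Measure.pi fun _ : Fin n => gaussianReal 0 1) :=
  .pi fun _ => isLogConcave_gaussianReal_zero_one

/-! ### Šidák's inequality -/

/-- Chebyshev's association inequality for a symmetric interval and a function that decreases
with `|x|`. -/
theorem measure_abs_le_mul_lintegral_le {ν : Measure ℝ} [IsProbabilityMeasure ν] {h : ℝ → ℝ≥0∞}
    (hanti : ∀ x y, |x| ≤ |y| → h y ≤ h x) (s : ℝ) :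
    ν {x | |x| ≤ s} * ∫⁻ x, h x ∂ν ≤ ∫⁻ x in {x | |x| ≤ s}, h x ∂ν := by
  rcases lt_or_ge s 0 with hs | hs
  · have : {x : ℝ | |x| ≤ s} = ∅ := by
      ext x; simpa using hs.trans_le (abs_nonneg x)
    simp [this]
  set A := {x : ℝ | |x| ≤ s}
  have hA : MeasurableSet A := measurableSet_le (by fun_prop) (by fun_prop)
  have h1 : h s * ν A ≤ ∫⁻ x in A, h x ∂ν := by
    rw [← setLIntegral_const]
    exact setLIntegral_mono' hA fun x hx => hanti x s (hx.trans (le_abs_self s))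
  have h2 : ∫⁻ x in Aᶜ, h x ∂ν ≤ h s * ν Aᶜ := by
    rw [← setLIntegral_const]
    exact setLIntegral_mono' hA.compl fun x hx =>
      hanti s x ((abs_of_nonneg hs).trans_le (le_of_not_ge hx))
  calc ν A * ∫⁻ x, h x ∂ν
      = ν A * ∫⁻ x in A, h x ∂ν + ν A * ∫⁻ x in Aᶜ, h x ∂ν := by
        rw [← mul_add, lintegral_add_compl _ hA]
    _ ≤ ν A * ∫⁻ x in A, h x ∂ν + ν Aᶜ * ∫⁻ x in A, h x ∂ν := by
        refine add_le_add le_rfl ?_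
        calc ν A * ∫⁻ x in Aᶜ, h x ∂ν ≤ ν A * (h s * ν Aᶜ) := by gcongr
          _ = ν Aᶜ * (h s * ν A) := by ring
          _ ≤ _ := by gcongr
    _ = ∫⁻ x in A, h x ∂ν := by rw [← add_mul, prob_add_prob_compl hA, one_mul]

section Sidak

variable {E ι : Type*} [NormedAddCommGroup E] [NormedSpace ℝ E] [MeasurableSpace E] [BorelSpace E]
  {μ : Measure E}

/-- A one-parameter form of Anderson's inequality: moving the centres of finitely or countably many
slabs away from the origin, all in proportion to one parameter, decreases the measure of their
intersection. -/
theorem measure_shifted_slabs_le (hμ : IsLogConcave μ) (hneg : μ.map Neg.neg = μ) [Countable ι]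
    (W : ι → E →L[ℝ] ℝ) (c t : ι → ℝ) {x y : ℝ} (hxy : |x| ≤ |y|) :
    μ {z | ∀ i, |W i z + y * c i| ≤ t i} ≤ μ {z | ∀ i, |W i z + x * c i| ≤ t i} := by
  set K : ℝ → Set E := fun x => {z | ∀ i, |W i z + x * c i| ≤ t i}
  have hK (x) : MeasurableSet (K x) := by
    simp only [K, Set.ofPred_forall]
    exact .iInter fun i => measurableSet_le (by fun_prop) (by fun_prop)
  have hKneg (x) : μ (K (-x)) = μ (K x) := by
    conv_lhs => rw [← hneg, Measure.map_apply measurable_neg (hK _)]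
    congr 1
    ext z
    simp only [K, Set.mem_preimage, Set.mem_ofPred_eq]
    refine forall_congr' fun i => ?_
    rw [← abs_neg]
    simp [add_comm]
  change μ (K y) ≤ μ (K x)
  rcases hxy.eq_or_lt with h | h
  · rcases abs_eq_abs.1 h with rfl | rfl
    · rfl
    · rw [hKneg]
  have hy : y ≠ 0 := abs_pos.1 ((abs_nonneg x).trans_lt h)
  -- `x` is the convex combination of `y` and `-y` with weights `1 - l` and `l`.
  obtain ⟨l, rfl⟩ : ∃ l, x = (1 - 2 * l) * y := ⟨(1 - x / y) / 2, by field_simp; ring⟩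
  rw [abs_mul, mul_lt_iff_lt_one_left (abs_pos.2 hy), abs_lt] at h
  have h0 : 0 < l := by linarith
  have h1 : l < 1 := by linarith
  calc μ (K y) = μ (K y) ^ (1 - l) * μ (K (-y)) ^ l := by
        rw [hKneg, ENNReal.rpow_one_sub_mul_rpow h0 h1]
    _ ≤ μ (K ((1 - 2 * l) * y)) := by
        refine hμ.measure_rpow_mul_le h0 h1 (hK _) (hK _) (hK _) fun u hu v hv i => ?_
        calc |W i ((1 - l) • u + l • v) + (1 - 2 * l) * y * c i|
            = |(1 - l) * (W i u + y * c i) + l * (W i v + -y * c i)| := by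
              congr 1
              simp only [map_add, map_smul, smul_eq_mul]
              ring
          _ ≤ (1 - l) * |W i u + y * c i| + l * |W i v + -y * c i| := by
              refine (abs_add_le _ _).trans_eq ?_
              rw [abs_mul, abs_mul, abs_of_pos h0, abs_of_pos (sub_pos.2 h1)]
          _ ≤ (1 - l) * t i + l * t i := by
              have := sub_pos.2 h1
              gcongr
              exacts [hu i, hv i]
          _ = t i := by ring

variable [SecondCountableTopology E] [IsGaussian μ]

/-- The key step in Šidák's inequality: conditioning on `Y`, each `X i` is the sum of a part
`W i` independent of `Y` and a multiple of `Y`, so the conditional probability of the slabs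
decreases with `|Y|`. -/
theorem measure_slab_mul_le_measure_inter (hμ : IsLogConcave μ) (hneg : μ.map Neg.neg = μ)
    [Finite ι] (Y : E →L[ℝ] ℝ) (X : ι → E →L[ℝ] ℝ) (s : ℝ) (t : ι → ℝ) :
    μ {z | |Y z| ≤ s} * μ {z | ∀ i, |X i z| ≤ t i} ≤
      μ {z | |Y z| ≤ s ∧ ∀ i, |X i z| ≤ t i} := by
  have := Fintype.ofFinite ι
  have hid : HasGaussianLaw (id : E → E) μ := IsGaussian.hasGaussianLaw_id
  have hL2 (L : E →L[ℝ] ℝ) : MemLp L 2 μ := (hid.map L).memLp_two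
  set c : ι → ℝ := fun i => cov[X i, Y; μ] / Var[Y; μ] with hc
  set W : ι → E →L[ℝ] ℝ := fun i => X i - c i • Y with hW
  have hXW (i z) : X i z = W i z + Y z * c i := by simp [hW, mul_comm]
  have hcov (i) : cov[Y, W i; μ] = 0 := by
    have : cov[Y, W i; μ] = cov[Y, X i; μ] - c i * Var[Y; μ] := by
      rw [hW, FunLike.coe_sub, FunLike.coe_smul,
        covariance_sub_right (hL2 Y) (hL2 (X i)) ((hL2 Y).const_smul _), covariance_smul_right,
        covariance_self (by fun_prop)]
    rw [this, covariance_comm]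
    rcases eq_or_ne Var[Y; μ] 0 with hv | hv
    · -- Here `Y` is almost surely constant.
      rw [hv, mul_zero, sub_zero]
      refine integral_eq_zero_of_ae ?_
      filter_upwards [(ae_eq_integral_of_variance_eq_zero (hL2 Y) hv)] with z hz
      simp [hz]
    · simp [hc, hv]
  have hindep : IndepFun (fun z (_ : Unit) => Y z) (fun z i => W i z) μ :=
    HasGaussianLaw.indepFun_of_covariance_eval
      (hid.map ((ContinuousLinearMap.pi fun _ : Unit => Y).prod (ContinuousLinearMap.pi W)))
      fun _ i => hcov i
  have hindep' : IndepFun (fun z => Y z) (fun z i => W i z) μ :=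
    hindep.comp (φ := fun u : Unit → ℝ => u ()) (ψ := fun v : ι → ℝ => v) (by fun_prop) measurable_id
  have hWm : Measurable fun z i => W i z := measurable_pi_iff.2 fun i => by fun_prop
  have hmap := hindep'.map_prod_eq_prod_map_map (by fun_prop) hWm.aemeasurable
  have hYm : Measurable fun z => Y z := by fun_prop
  have : IsProbabilityMeasure (μ.map fun z => Y z) := Measure.isProbabilityMeasure_map (by fun_prop)
  set B : Set (ℝ × (ι → ℝ)) := {p | ∀ i, |p.2 i + p.1 * c i| ≤ t i} with hB
  have hBm : MeasurableSet B := by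
    simp only [B, Set.ofPred_forall]
    exact .iInter fun i => measurableSet_le (by fun_prop) (by fun_prop)
  have hsec (x : ℝ) : (μ.map fun z i => W i z) (Prod.mk x ⁻¹' B) =
      μ {z | ∀ i, |W i z + x * c i| ≤ t i} := by
    rw [Measure.map_apply hWm (hBm.preimage measurable_prodMk_left)]
    rfl
  have key (A : Set ℝ) (hA : MeasurableSet A) : μ {z | Y z ∈ A ∧ ∀ i, |X i z| ≤ t i} =
      ∫⁻ x in A, μ {z | ∀ i, |W i z + x * c i| ≤ t i} ∂(μ.map fun z => Y z) := by
    have hset : {z | Y z ∈ A ∧ ∀ i, |X i z| ≤ t i} =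
        (fun z => (Y z, fun i => W i z)) ⁻¹' (Prod.fst ⁻¹' A ∩ B) := by
      ext z; simp [hXW, hB]
    rw [hset, ← Measure.map_apply (hYm.prodMk hWm) ((hA.preimage measurable_fst).inter hBm), hmap,
      Measure.prod_apply ((hA.preimage measurable_fst).inter hBm), ← lintegral_indicator hA]
    refine lintegral_congr fun x => ?_
    by_cases hx : x ∈ A
    · rw [Set.indicator_of_mem hx, ← hsec]
      congr 1
      ext w
      simp [hx]
    · rw [Set.indicator_of_notMem hx]
      refine measure_mono_null (t := ∅) (fun w hw => hx hw.1) measure_empty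
  have hA : MeasurableSet {x : ℝ | |x| ≤ s} := measurableSet_le (by fun_prop) (by fun_prop)
  have h1 := key _ hA
  have h2 := key _ .univ
  simp only [Set.mem_ofPred_eq, Set.mem_univ, true_and, Measure.restrict_univ] at h1 h2
  rw [h1, h2, show μ {z | |Y z| ≤ s} = (μ.map fun z => Y z) {x | |x| ≤ s} from
    (Measure.map_apply hYm hA).symm]
  exact measure_abs_le_mul_lintegral_le (fun x y hxy => measure_shifted_slabs_le hμ hneg W c t hxy) s

/-- **Šidák's inequality**: symmetric slabs are positively correlated under a centred Gaussian
measure. -/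
theorem prod_measure_slab_le (hμ : IsLogConcave μ) (hneg : μ.map Neg.neg = μ)
    [Finite ι] (X : ι → E →L[ℝ] ℝ) (t : ι → ℝ) (S : Finset ι) :
    ∏ i ∈ S, μ {z | |X i z| ≤ t i} ≤ μ {z | ∀ i ∈ S, |X i z| ≤ t i} := by
  classical
  induction S using Finset.induction_on with
  | empty => simp
  | insert k S hk ih =>
    rw [Finset.prod_insert hk]
    have := measure_slab_mul_le_measure_inter hμ hneg (X k) (fun i : S => X i) (t k) fun i => t i
    refine (mul_le_mul_right ih _).trans ?_
    simpa using this

end Sidak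

/-! ### Gaussian comparison -/

instance isGaussian_pi_gaussianReal (n : ℕ) :
    IsGaussian (Measure.pi fun _ : Fin n => gaussianReal 0 1) := by
  have h := iIndepFun_pi (μ := fun _ : Fin n => gaussianReal 0 1) (X := fun _ x => x)
    (fun _ => aemeasurable_id)
  have hlaw (i : Fin n) : HasGaussianLaw (fun x : Fin n → ℝ => x i)
      (Measure.pi fun _ : Fin n => gaussianReal 0 1) := by
    refine ⟨?_⟩
    rw [(measurePreserving_eval (fun _ : Fin n => gaussianReal 0 1) i).map_eq]
    infer_instance
  simpa using (iIndepFun.hasGaussianLaw hlaw h).isGaussian_map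

theorem map_neg_pi_gaussianReal (n : ℕ) :
    (Measure.pi fun _ : Fin n => gaussianReal 0 1).map Neg.neg =
      Measure.pi fun _ : Fin n => gaussianReal 0 1 := by
  have := Measure.pi_map_pi (μ := fun _ : Fin n => gaussianReal 0 1) (f := fun _ x => -x)
    (fun _ => measurable_neg.aemeasurable)
  simp only [gaussianReal_map_neg, neg_zero] at this
  exact this

theorem map_const_mul_pi_gaussianReal {n : ℕ} (v : Fin n → ℝ≥0) :
    (Measure.pi fun _ : Fin n => gaussianReal 0 1).map (fun z i => √(v i) * z i) =
      Measure.pi fun i => gaussianReal 0 (v i) := by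
  rw [Measure.pi_map_pi (μ := fun _ : Fin n => gaussianReal 0 1) (f := fun i x => √(v i) * x)
    (fun _ => by fun_prop)]
  congr 1
  ext1 i
  rw [gaussianReal_map_const_mul]
  congr 1
  · simp
  · ext; simp

theorem map_mulVec_apply_pi_gaussianReal {n : ℕ} (A : Matrix (Fin n) (Fin n) ℝ) (i : Fin n) :
    (Measure.pi fun _ : Fin n => gaussianReal 0 1).map (fun z => A.mulVec z i) =
      gaussianReal 0 (∑ j, A i j ^ 2).toNNReal := by
  have hid : HasGaussianLaw id (Measure.pi fun _ : Fin n => gaussianReal 0 1) :=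
    IsGaussian.hasGaussianLaw_id
  have hL : HasGaussianLaw (fun z => A.mulVec z i)
      (Measure.pi fun _ : Fin n => gaussianReal 0 1) :=
    hid.map ((ContinuousLinearMap.proj i).comp (A.mulVecLin.toContinuousLinearMap))
  have heq : (fun z => A.mulVec z i) = ∑ j, fun z : Fin n → ℝ => A i j * z j := by
    ext z; simp [Matrix.mulVec, dotProduct]
  rw [hL.map_eq_gaussianReal]
  congr 1
  · simp only [Matrix.mulVec, dotProduct]
    rw [integral_finsetSum _ fun j _ => ?_]
    · refine Finset.sum_eq_zero fun j _ => ?_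
      rw [integral_const_mul, integral_eval]
      simp
    · exact (hid.eval j).integrable.const_mul _
  · congr 1
    rw [heq, variance_sum_pi (X := fun j x => A i j * x)]
    · refine Finset.sum_congr rfl fun j _ => ?_
      rw [variance_const_mul]
      have := variance_id_gaussianReal (μ := 0) (v := 1)
      simp [show Var[fun x => x; gaussianReal 0 1] = _ from this]
    · exact fun j => IsGaussian.memLp_two_id.const_mul _

theorem sq_pi_norm_le_iff {n : ℕ} (x : Fin n → ℝ) {t : ℝ} (ht : 0 ≤ t) :
    ‖x‖ ^ 2 ≤ t ↔ ∀ i, |x i| ≤ √t := by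
  rw [← Real.le_sqrt (norm_nonneg _) ht, pi_norm_le_iff_of_nonneg (Real.sqrt_nonneg _)]
  rfl

/-- Among Gaussian vectors with prescribed variances of the coordinates, independent coordinates
make the expected square of the sup norm largest. -/
theorem lintegral_sq_norm_mulVec_le {n : ℕ} (A : Matrix (Fin n) (Fin n) ℝ) :
    ∫⁻ z, ENNReal.ofReal (‖A.mulVec z‖ ^ 2) ∂(Measure.pi fun _ : Fin n => gaussianReal 0 1) ≤
      ∫⁻ z, ENNReal.ofReal (‖fun i => √(∑ j, A i j ^ 2) * z i‖ ^ 2)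
        ∂(Measure.pi fun _ : Fin n => gaussianReal 0 1) := by
  set γ := Measure.pi fun _ : Fin n => gaussianReal 0 1 with hγ
  have hA : Continuous fun z : Fin n → ℝ => A.mulVec z := by fun_prop
  have hD : Continuous fun (z : Fin n → ℝ) i => √(∑ j, A i j ^ 2) * z i := by fun_prop
  rw [lintegral_eq_lintegral_meas_lt _ (.of_forall fun z => sq_nonneg _)
      (hA.norm.pow 2).measurable.aemeasurable,
    lintegral_eq_lintegral_meas_lt _ (.of_forall fun z => sq_nonneg _)
      (hD.norm.pow 2).measurable.aemeasurable]
  refine setLIntegral_mono' measurableSet_Ioi fun t ht => ?_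
  have ht : 0 ≤ t := le_of_lt ht
  have hcompl (u : (Fin n → ℝ) → (Fin n → ℝ)) (hu : Continuous u) :
      γ {z | t < ‖u z‖ ^ 2} = 1 - γ {z | ∀ i, |u z i| ≤ √t} := by
    rw [← prob_compl_eq_one_sub]
    · congr 1
      ext z
      simp only [Set.mem_ofPred_eq, Set.mem_compl_iff, ← sq_pi_norm_le_iff (u z) ht, not_le]
    · simp only [Set.ofPred_forall]
      exact .iInter fun i => measurableSet_le (by fun_prop) (by fun_prop)
  rw [hcompl _ hA, hcompl _ hD]
  refine tsub_le_tsub_left ?_ _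
  have hI : MeasurableSet {x : ℝ | |x| ≤ √t} := measurableSet_le (by fun_prop) (by fun_prop)
  calc γ {z | ∀ i, |√(∑ j, A i j ^ 2) * z i| ≤ √t}
      = (Measure.pi fun i => gaussianReal 0 (∑ j, A i j ^ 2).toNNReal)
          (Set.univ.pi fun _ => {x | |x| ≤ √t}) := by
        rw [← map_const_mul_pi_gaussianReal, Measure.map_apply (by fun_prop)
          (.univ_pi fun _ => hI)]
        congr 1
        ext z
        simp [Real.coe_toNNReal _ (Finset.sum_nonneg fun j _ => sq_nonneg (A _ j))]
    _ = ∏ i, γ {z | |A.mulVec z i| ≤ √t} := by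
        rw [Measure.pi_pi]
        refine Finset.prod_congr rfl fun i _ => ?_
        rw [← map_mulVec_apply_pi_gaussianReal, Measure.map_apply (by fun_prop) hI]
        rfl
    _ ≤ γ {z | ∀ i, |A.mulVec z i| ≤ √t} := by
        simpa using prod_measure_slab_le (isLogConcave_pi_gaussianReal n)
          (map_neg_pi_gaussianReal n)
          (fun i => (ContinuousLinearMap.proj i).comp (A.mulVecLin.toContinuousLinearMap))
          (fun _ => √t) Finset.univ

/-! ### Majorization by the eigenvalues -/

theorem norm_comp_perm {n : ℕ} (π : Equiv.Perm (Fin n)) (x : Fin n → ℝ) : ‖x ∘ π‖ = ‖x‖ := by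
  refine le_antisymm ?_ ?_ <;> refine (pi_norm_le_iff_of_nonneg (norm_nonneg _)).2 fun i => ?_
  · exact norm_le_pi_norm x (π i)
  · simpa using norm_le_pi_norm (x ∘ π) (π.symm i)

theorem lintegral_sq_norm_perm {n : ℕ} (π : Equiv.Perm (Fin n)) (v : Fin n → ℝ) :
    ∫⁻ z, ENNReal.ofReal (‖fun i => √(v (π i)) * z i‖ ^ 2)
        ∂(Measure.pi fun _ : Fin n => gaussianReal 0 1) =
      ∫⁻ z, ENNReal.ofReal (‖fun i => √(v i) * z i‖ ^ 2)
        ∂(Measure.pi fun _ : Fin n => gaussianReal 0 1) := by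
  have h := measurePreserving_piCongrLeft (fun _ : Fin n => gaussianReal 0 1) π
  rw [← h.lintegral_comp_emb (MeasurableEquiv.measurableEmbedding _)
    fun z => ENNReal.ofReal (‖fun i => √(v i) * z i‖ ^ 2)]
  refine lintegral_congr fun z => ?_
  rw [← norm_comp_perm π fun i => √(v i) * (MeasurableEquiv.piCongrLeft (fun _ => ℝ) π) z i]
  congr 3
  ext i
  simp only [Function.comp_apply]
  congr 1
  exact (Equiv.piCongrLeft_apply_apply (fun _ : Fin n => ℝ) π z i).symm

/-- The expected maximum of `v i * z i ^ 2` is a convex symmetric function of the variances `v`,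
so it increases when a doubly stochastic averaging of the variances is undone. -/
theorem lintegral_sq_norm_doublyStochastic_le {n : ℕ} {M : Matrix (Fin n) (Fin n) ℝ}
    (hM : M ∈ doublyStochastic ℝ (Fin n)) (v : Fin n → ℝ) (hv : ∀ i, 0 ≤ v i) :
    ∫⁻ z, ENNReal.ofReal (‖fun i => √(M.mulVec v i) * z i‖ ^ 2)
        ∂(Measure.pi fun _ : Fin n => gaussianReal 0 1) ≤
      ∫⁻ z, ENNReal.ofReal (‖fun i => √(v i) * z i‖ ^ 2)
        ∂(Measure.pi fun _ : Fin n => gaussianReal 0 1) := by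
  obtain ⟨w, hw0, hw1, hwM⟩ := exists_eq_sum_perm_of_mem_doublyStochastic hM
  have hMv (i) : M.mulVec v i = ∑ π, w π * v (π i) := by
    simp [← hwM, Matrix.sum_mulVec, Matrix.smul_mulVec, Matrix.permMatrix_mulVec]
  have hconv (z : Fin n → ℝ) : ‖fun i => √(M.mulVec v i) * z i‖ ^ 2 ≤
      ∑ π, w π * ‖fun i => √(v (π i)) * z i‖ ^ 2 := by
    have hnn : 0 ≤ ∑ π, w π * ‖fun i => √(v (π i)) * z i‖ ^ 2 :=
      Finset.sum_nonneg fun π _ => mul_nonneg (hw0 π) (sq_nonneg _)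
    rw [sq_pi_norm_le_iff _ hnn]
    intro i
    refine Real.abs_le_sqrt ?_
    rw [mul_pow, Real.sq_sqrt (by
      rw [hMv]; exact Finset.sum_nonneg fun π _ => mul_nonneg (hw0 π) (hv _)), hMv, Finset.sum_mul]
    refine Finset.sum_le_sum fun π _ => ?_
    rw [mul_assoc]
    refine mul_le_mul_of_nonneg_left ?_ (hw0 π)
    calc v (π i) * z i ^ 2 = ‖√(v (π i)) * z i‖ ^ 2 := by
          rw [Real.norm_eq_abs, sq_abs, mul_pow, Real.sq_sqrt (hv _)]
      _ ≤ _ := by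
          gcongr
          exact norm_le_pi_norm (fun i => √(v (π i)) * z i) i
  refine (lintegral_mono fun z => ENNReal.ofReal_le_ofReal (hconv z)).trans_eq ?_
  have hsplit (z : Fin n → ℝ) : ENNReal.ofReal (∑ π, w π * ‖fun i => √(v (π i)) * z i‖ ^ 2) =
      ∑ π, ENNReal.ofReal (w π) * ENNReal.ofReal (‖fun i => √(v (π i)) * z i‖ ^ 2) := by
    rw [ENNReal.ofReal_sum_of_nonneg fun π _ => mul_nonneg (hw0 π) (sq_nonneg _)]
    simp_rw [ENNReal.ofReal_mul (hw0 _)]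
  have hmeas (π : Equiv.Perm (Fin n)) :
      Measurable fun z : Fin n → ℝ => ENNReal.ofReal (‖fun i => √(v (π i)) * z i‖ ^ 2) := by
    have : Continuous fun (z : Fin n → ℝ) i => √(v (π i)) * z i := by fun_prop
    exact (this.norm.pow 2).measurable.ennreal_ofReal
  simp_rw [hsplit]
  rw [lintegral_finsetSum _ fun π _ => (hmeas π).const_mul _]
  simp_rw [lintegral_const_mul _ (hmeas _), lintegral_sq_norm_perm]
  rw [← Finset.sum_mul, ← ENNReal.ofReal_sum_of_nonneg fun π _ => hw0 π, hw1]
  simp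

/-! ### The reconstruction error -/

theorem sqErr_one_eq {N : ℕ} (hN : 0 < N) (x : Fin N → ℝ) :
    sqErr 1 x = ∑ i, x i ^ 2 - ‖x‖ ^ 2 := by
  have : Nonempty (Fin N) := ⟨⟨0, hN⟩⟩
  have herase (i : Fin N) : ∑ j ∈ Finset.univ.erase i, x j ^ 2 = ∑ j, x j ^ 2 - x i ^ 2 :=
    Finset.sum_erase_eq_sub (Finset.mem_univ i)
  refine le_antisymm ?_ (Finset.le_inf' _ _ fun S hS => ?_)
  · obtain ⟨i, hi⟩ := Finite.exists_max fun i => ‖x i‖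
    have hnorm : ‖x‖ = |x i| :=
      le_antisymm ((pi_norm_le_iff_of_nonneg (norm_nonneg _)).2 hi) (norm_le_pi_norm x i)
    rw [hnorm, sq_abs, ← herase]
    exact Finset.inf'_le _ (by simp [Finset.mem_powersetCard])
  · obtain ⟨-, hS⟩ := Finset.mem_powersetCard.1 hS
    obtain ⟨i, hi⟩ := Finset.card_eq_one.1 (show Sᶜ.card = 1 by
      rw [Finset.card_compl, hS, Fintype.card_fin]; omega)
    rw [← compl_compl S, hi, Finset.compl_singleton, herase]
    have : x i ^ 2 ≤ ‖x‖ ^ 2 := by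
      rw [← sq_abs (x i)]
      gcongr
      exact norm_le_pi_norm x i
    linarith

theorem sum_sq_orthogonal_mulVec {N : ℕ} (T : Matrix.orthogonalGroup (Fin N) ℝ)
    (y : Fin N → ℝ) :
    ∑ i, Matrix.mulVec (T : Matrix (Fin N) (Fin N) ℝ) y i ^ 2 = ∑ i, y i ^ 2 := by
  have h : Matrix.transpose (T : Matrix (Fin N) (Fin N) ℝ) * T = 1 := by
    simpa [Matrix.star_eq_conjTranspose] using (Matrix.mem_orthogonalGroup_iff' (Fin N) ℝ).1 T.2
  have := Matrix.dotProduct_mulVec (Matrix.mulVec (T : Matrix (Fin N) (Fin N) ℝ) y) T.1 y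
  rw [← Matrix.mulVec_transpose, Matrix.mulVec_mulVec, h, Matrix.one_mulVec] at this
  simpa [dotProduct, sq] using this

theorem sq_entries_mem_doublyStochastic {N : ℕ} (T : Matrix.orthogonalGroup (Fin N) ℝ) :
    (Matrix.of fun i j => (T : Matrix (Fin N) (Fin N) ℝ) i j ^ 2) ∈
      doublyStochastic ℝ (Fin N) := by
  refine mem_doublyStochastic_iff_sum.2 ⟨fun i j => sq_nonneg _, fun i => ?_, fun j => ?_⟩
  · have := congr_fun₂ ((Matrix.mem_orthogonalGroup_iff (Fin N) ℝ).1 T.2) i i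
    simpa [Matrix.mul_apply, sq] using this
  · have := congr_fun₂ ((Matrix.mem_orthogonalGroup_iff' (Fin N) ℝ).1 T.2) j j
    simpa [Matrix.mul_apply, sq] using this

theorem norm_mulVec_le_of_mem_signedPerms {N : ℕ} {T : Matrix.orthogonalGroup (Fin N) ℝ}
    (hT : T ∈ signedPerms N) (y : Fin N → ℝ) :
    ‖Matrix.mulVec (T : Matrix (Fin N) (Fin N) ℝ) y‖ ≤ ‖y‖ := by
  refine (pi_norm_le_iff_of_nonneg (norm_nonneg _)).2 fun i => ?_
  calc ‖Matrix.mulVec (T : Matrix (Fin N) (Fin N) ℝ) y i‖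
      ≤ ∑ j, ‖(T : Matrix (Fin N) (Fin N) ℝ) i j * y j‖ :=
        norm_sum_le Finset.univ fun j => (T : Matrix (Fin N) (Fin N) ℝ) i j * y j
    _ ≤ ∑ j, (T : Matrix (Fin N) (Fin N) ℝ) i j ^ 2 * ‖y‖ := by
        refine Finset.sum_le_sum fun j _ => ?_
        have hy : |y j| ≤ ‖y‖ := norm_le_pi_norm y j
        -- An entry in `{0, 1, -1}` satisfies `|a| = a ^ 2`.
        rcases hT i j with h | h | h <;> simp [h, hy]
    _ = ‖y‖ := by
        have := (mem_doublyStochastic_iff_sum.1 (sq_entries_mem_doublyStochastic T)).2.1 i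
        simp only [Matrix.of_apply] at this
        rw [← Finset.sum_mul, this, one_mul]

theorem inv_mem_signedPerms {N : ℕ} {T : Matrix.orthogonalGroup (Fin N) ℝ}
    (hT : T ∈ signedPerms N) : T⁻¹ ∈ signedPerms N :=
  fun i j => by simpa using hT j i

theorem norm_mulVec_of_mem_signedPerms {N : ℕ} {T : Matrix.orthogonalGroup (Fin N) ℝ}
    (hT : T ∈ signedPerms N) (y : Fin N → ℝ) :
    ‖Matrix.mulVec (T : Matrix (Fin N) (Fin N) ℝ) y‖ = ‖y‖ := by
  refine le_antisymm (norm_mulVec_le_of_mem_signedPerms hT y) ?_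
  have := norm_mulVec_le_of_mem_signedPerms (inv_mem_signedPerms hT)
    (Matrix.mulVec (T : Matrix (Fin N) (Fin N) ℝ) y)
  rwa [Matrix.mulVec_mulVec, ← Submonoid.coe_mul, inv_mul_cancel, Submonoid.coe_one,
    Matrix.one_mulVec] at this

theorem one_mem_signedPerms (N : ℕ) : 1 ∈ signedPerms N := fun i j => by
  by_cases h : i = j <;> simp [h]

theorem sqErrAt_one_eq {Ω : Type*} {N : ℕ} (hN : 0 < N) (Y : Ω → Fin N → ℝ)
    (T : Matrix.orthogonalGroup (Fin N) ℝ) (ω : Ω) :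
    sqErrAt Y 1 T ω =
      ∑ i, Y ω i ^ 2 - ‖Matrix.mulVec (T : Matrix (Fin N) (Fin N) ℝ) (Y ω)‖ ^ 2 := by
  rw [sqErrAt, sqErr_one_eq hN, sum_sq_orthogonal_mulVec]

/-- An orthogonal transformation of independent centred Gaussians does not increase the expected
square of the sup norm. -/
theorem lintegral_sq_norm_orthogonal_le {Ω : Type*} [MeasurableSpace Ω] {P : Measure Ω}
    [IsProbabilityMeasure P] {N : ℕ} {σ : Fin N → ℝ≥0} {Y : Ω → Fin N → ℝ}
    (hlaw : ∀ i, HasLaw (fun ω => Y ω i) (gaussianReal 0 (σ i)) P)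
    (hindep : iIndepFun (fun i ω => Y ω i) P) (T : Matrix.orthogonalGroup (Fin N) ℝ) :
    ∫⁻ ω, ENNReal.ofReal (‖Matrix.mulVec (T : Matrix (Fin N) (Fin N) ℝ) (Y ω)‖ ^ 2) ∂P ≤
      ∫⁻ ω, ENNReal.ofReal (‖Y ω‖ ^ 2) ∂P := by
  have hYm : AEMeasurable Y P := aemeasurable_pi_iff.2 fun i => (hlaw i).aemeasurable
  have hYlaw : P.map Y =
      (Measure.pi fun _ : Fin N => gaussianReal 0 1).map (fun z i => √(σ i) * z i) := by
    rw [map_const_mul_pi_gaussianReal]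
    refine (hindep.map_fun_eq_pi_map fun i => (hlaw i).aemeasurable).trans ?_
    simp_rw [(hlaw _).map_eq]
  have transfer (F : (Fin N → ℝ) → ℝ≥0∞) (hF : Measurable F) :
      ∫⁻ ω, F (Y ω) ∂P = ∫⁻ z, F (fun i => √(σ i) * z i)
        ∂(Measure.pi fun _ : Fin N => gaussianReal 0 1) := by
    rw [← lintegral_map' hF.aemeasurable hYm, hYlaw, lintegral_map hF (by fun_prop)]
  have hTc : Continuous fun y => Matrix.mulVec (T : Matrix (Fin N) (Fin N) ℝ) y := by fun_prop
  rw [transfer (fun y => ENNReal.ofReal (‖y‖ ^ 2)) (by fun_prop),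
    transfer (fun y => ENNReal.ofReal (‖Matrix.mulVec (T : Matrix (Fin N) (Fin N) ℝ) y‖ ^ 2))
      (hTc.norm.pow 2).measurable.ennreal_ofReal]
  have hcomp (z : Fin N → ℝ) : Matrix.mulVec (T : Matrix (Fin N) (Fin N) ℝ)
      (fun i => √(σ i) * z i) = Matrix.mulVec (T.1 * Matrix.diagonal fun i => √(σ i)) z := by
    rw [← Matrix.mulVec_mulVec]
    congr 1
    ext i
    simp [Matrix.mulVec_diagonal]
  simp_rw [hcomp]
  refine (lintegral_sq_norm_mulVec_le _).trans ?_
  refine le_trans (le_of_eq ?_) (lintegral_sq_norm_doublyStochastic_le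
    (sq_entries_mem_doublyStochastic T) (fun i => (σ i : ℝ)) fun i => (σ i).2)
  simp [Matrix.mulVec, dotProduct, mul_pow]

theorem lemma1 {Ω : Type*} [MeasurableSpace Ω] (P : Measure Ω) [IsProbabilityMeasure P]
    (N : ℕ) (hN : 1 < N) (σ : Fin N → ℝ≥0) (hσ : Antitone σ)
    (Y : Ω → Fin N → ℝ)
    (hlaw : ∀ i, HasLaw (fun ω => Y ω i) (gaussianReal 0 (σ i)) P)
    (hindep : iIndepFun (fun i ω => Y ω i) P) :
    (∀ T : Matrix.orthogonalGroup (Fin N) ℝ, Integrable (sqErrAt Y 1 T) P) ∧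
    IsLeast (Set.range (meanSqErr P Y 1)) (meanSqErr P Y 1 1) ∧
    IsLeast (meanSqErr P Y 1 '' signedPerms N) (meanSqErr P Y 1 1) ∧
    ∀ T ∈ signedPerms N, meanSqErr P Y 1 T = meanSqErr P Y 1 1 := by
  have hN0 : 0 < N := by omega
  have hYm : AEMeasurable Y P := aemeasurable_pi_iff.2 fun i => (hlaw i).aemeasurable
  have hsum : Integrable (fun ω => ∑ i, Y ω i ^ 2) P :=
    integrable_finsetSum _ fun i _ => (hlaw i).hasGaussianLaw.memLp_two.integrable_sq
  have hnorm (T : Matrix.orthogonalGroup (Fin N) ℝ) :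
      Integrable (fun ω => ‖Matrix.mulVec (T : Matrix (Fin N) (Fin N) ℝ) (Y ω)‖ ^ 2) P := by
    have hTc : Continuous fun y => Matrix.mulVec (T : Matrix (Fin N) (Fin N) ℝ) y := by fun_prop
    refine hsum.mono'
      ((hTc.norm.pow 2).measurable.comp_aemeasurable hYm).aestronglyMeasurable
      (.of_forall fun ω => ?_)
    rw [Real.norm_of_nonneg (sq_nonneg _), ← sum_sq_orthogonal_mulVec T,
      sq_pi_norm_le_iff _ (Finset.sum_nonneg fun i _ => sq_nonneg _)]
    exact fun i => Real.abs_le_sqrt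
      (Finset.single_le_sum (f := fun i => Matrix.mulVec T.1 (Y ω) i ^ 2)
        (fun j _ => sq_nonneg _) (Finset.mem_univ i))
  have hmean (T : Matrix.orthogonalGroup (Fin N) ℝ) : meanSqErr P Y 1 T =
      ∫ ω, ∑ i, Y ω i ^ 2 ∂P -
        ∫ ω, ‖Matrix.mulVec (T : Matrix (Fin N) (Fin N) ℝ) (Y ω)‖ ^ 2 ∂P := by
    rw [← integral_sub hsum (hnorm T)]
    exact integral_congr_ae (.of_forall fun ω => sqErrAt_one_eq hN0 Y T ω)
  have hle (T : Matrix.orthogonalGroup (Fin N) ℝ) : meanSqErr P Y 1 1 ≤ meanSqErr P Y 1 T := by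
    rw [hmean, hmean]
    refine sub_le_sub_left ?_ _
    rw [← ENNReal.ofReal_le_ofReal_iff (integral_nonneg fun ω => sq_nonneg _),
      ofReal_integral_eq_lintegral_ofReal (hnorm T) (.of_forall fun ω => sq_nonneg _),
      ofReal_integral_eq_lintegral_ofReal (hnorm 1) (.of_forall fun ω => sq_nonneg _)]
    simpa using lintegral_sq_norm_orthogonal_le hlaw hindep T
  have hsigned (T : Matrix.orthogonalGroup (Fin N) ℝ) (hT : T ∈ signedPerms N) :
      meanSqErr P Y 1 T = meanSqErr P Y 1 1 := by
    simp_rw [hmean, norm_mulVec_of_mem_signedPerms hT,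
      norm_mulVec_of_mem_signedPerms (one_mem_signedPerms N)]
  refine ⟨fun T => ?_, ⟨⟨1, rfl⟩, ?_⟩, ⟨⟨1, one_mem_signedPerms N, rfl⟩, ?_⟩, hsigned⟩
  · exact (hsum.sub (hnorm T)).congr (.of_forall fun ω => (sqErrAt_one_eq hN0 Y T ω).symm)
  · rintro _ ⟨T, rfl⟩
    exact hle T
  · rintro _ ⟨T, -, rfl⟩
    exact hle T
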